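/- Let $\mathbb F_q$ be a finite field of odd characteristic, let $n$ be an odd prime, and let $E_{a,d}: ax^2+y^2=1+dx^2y^2$ with $a,d\in\mathbb F_q\setminus\{0\}$, $a\neq d$, be a twisted Edwards curve over $\mathbb F_q$. Let $\varphi(x,y)=(x^q,y^q)$ be the Frobenius, $\mathcal O=(0,1)$ the neutral element of the twisted Edwards group law, $\mathcal O'=(0,-1)$, and let $\Omega_1=[1,0,0]$, $\Omega_2=[0,1,0]$ be the two points at infinity of the projective closure of $E_{a,d}$. Let $\mathcal T_n=\{P\in E_{a,d}(\mathbb F_{q^n}) : P+\varphi(P)+\dots+\varphi^{n-1}(P)=\mathcal O\}$ be the trace zero subgroup. For a polynomial $h(x,y)$ of total degree $m$ with homogenization $H(X,Y,Z)$, not vanishing identically on the curve, let $\operatorname{div}(h)$ be the divisor of $H/Z^m$ on the projective closure of $E_{a,d}$ over $\overline{\mathbb F}_q$; that is, the coefficient at a point $p$ is the intersection multiplicity at $p$ of the curve with $H=0$ minus $m$ times that with $Z=0$. Let $P=(u,v)\in\mathcal T_n$, and let $q_P(x,y)=(1+y)\hat q_1(y)+x\,q_2(y)$ with $\hat q_1,q_2\in\mathbb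 F_q[y]$ be a polynomial such that $$\operatorname{div}(q_P)=P+\varphi(P)+\dots+\varphi^{n-1}(P)+\mathcal O'-2\Omega_1-(n-1)\Omega_2 .$$ Then $Q_P(y)=(a-dy^2)(1+y)\hat q_1(y)^2+(y-1)q_2(y)^2\in\mathbb F_q[y]$ has degree exactly $n$, and its roots in $\overline{\mathbb F}_q$, counted with multiplicity, are $v,v^q,\dots,v^{q^{n-1}}$. -/

import Mathlib

namespace TwistedEdwards

noncomputable section

open scoped Classical

/-! ### The group of points

The group of `K`-rational points of `E_{a,d} : a x² + y² = 1 + d x² y²` is the group of points of its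
smooth model, the curve `a X² T² + Y² Z² = Z² T² + d X² Y²` in `ℙ¹ × ℙ¹` with `x = X / Z` and
`y = Y / T`.  It consists of the affine points and of those points above the two points at infinity
of the plane curve that are rational over `K`.  The projective line over `K` is `OnePoint K`. -/

/-- Homogeneous coordinates of a point of the projective line. -/
def hom {K : Type*} [Field K] (x : OnePoint K) : K × K :=
  x.elim (1, 0) (fun t => (t, 1))

/-- The point of the projective line with homogeneous coordinates `(X : Z)`. -/
def ofHom {K : Type*} [Field K] (X Z : K) : OnePoint K :=
  if Z = 0 then OnePoint.infty else ((X / Z : K) : OnePoint K)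

/-- The points of the smooth model of `E_{a,d}`. -/
def points {K : Type*} [Field K] (a d : K) : Set (OnePoint K × OnePoint K) :=
  {P | a * (hom P.1).1 ^ 2 * (hom P.2).2 ^ 2 + (hom P.2).1 ^ 2 * (hom P.1).2 ^ 2 =
    (hom P.1).2 ^ 2 * (hom P.2).2 ^ 2 + d * (hom P.1).1 ^ 2 * (hom P.2).1 ^ 2}

/-- The point with affine coordinates `(x, y)`. -/
def affinePt {K : Type*} [Field K] (x y : K) : OnePoint K × OnePoint K :=
  ((x : OnePoint K), (y : OnePoint K))

/-- The twisted Edwards addition law.  The first branch is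
`((x₁y₂ + x₂y₁) / (1 + d x₁x₂y₁y₂), (y₁y₂ - a x₁x₂) / (1 - d x₁x₂y₁y₂))` in homogeneous coordinates.
Where this is undefined (one of the two quotients reads `0 / 0`), the second branch is used; it is
`((x₁y₁ + x₂y₂) / (a x₁x₂ + y₁y₂), (x₁y₁ - x₂y₂) / (x₁y₂ - x₂y₁))`, which agrees with the first one
on the curve wherever both are defined. -/
def add {K : Type*} [Field K] (a d : K) (P Q : OnePoint K × OnePoint K) :
    OnePoint K × OnePoint K :=
  let X₁ := (hom P.1).1
  let Z₁ := (hom P.1).2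
  let Y₁ := (hom P.2).1
  let T₁ := (hom P.2).2
  let X₂ := (hom Q.1).1
  let Z₂ := (hom Q.1).2
  let Y₂ := (hom Q.2).1
  let T₂ := (hom Q.2).2
  let X₃ := X₁ * Y₂ * Z₂ * T₁ + X₂ * Y₁ * Z₁ * T₂
  let Z₃ := Z₁ * Z₂ * T₁ * T₂ + d * X₁ * X₂ * Y₁ * Y₂
  let Y₃ := Y₁ * Y₂ * Z₁ * Z₂ - a * X₁ * X₂ * T₁ * T₂
  let T₃ := Z₁ * Z₂ * T₁ * T₂ - d * X₁ * X₂ * Y₁ * Y₂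
  if (X₃ ≠ 0 ∨ Z₃ ≠ 0) ∧ (Y₃ ≠ 0 ∨ T₃ ≠ 0) then
    (ofHom X₃ Z₃, ofHom Y₃ T₃)
  else
    (ofHom (X₁ * Y₁ * Z₂ * T₂ + X₂ * Y₂ * Z₁ * T₁) (a * X₁ * X₂ * T₁ * T₂ + Y₁ * Y₂ * Z₁ * Z₂),
      ofHom (X₁ * Y₁ * Z₂ * T₂ - X₂ * Y₂ * Z₁ * T₁) (X₁ * Y₂ * Z₂ * T₁ - X₂ * Y₁ * Z₁ * T₂))

/-- On affine points with nonvanishing denominators `add` is the usual formula. -/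
theorem add_affine {K : Type*} [Field K] (a d x₁ y₁ x₂ y₂ : K)
    (h₁ : 1 + d * x₁ * x₂ * y₁ * y₂ ≠ 0) (h₂ : 1 - d * x₁ * x₂ * y₁ * y₂ ≠ 0) :
    add a d (affinePt x₁ y₁) (affinePt x₂ y₂) =
      affinePt ((x₁ * y₂ + x₂ * y₁) / (1 + d * x₁ * x₂ * y₁ * y₂))
        ((y₁ * y₂ - a * x₁ * x₂) / (1 - d * x₁ * x₂ * y₁ * y₂)) := by
  simp [add, affinePt, hom, ofHom, h₁, h₂]

/-- The Frobenius `(x, y) ↦ (x ^ q, y ^ q)`. -/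
def frob {K : Type*} [Field K] (q : ℕ) (P : OnePoint K × OnePoint K) : OnePoint K × OnePoint K :=
  (P.1.map (fun t => t ^ q), P.2.map (fun t => t ^ q))

/-- `P + φ(P) + ⋯ + φ^{n-1}(P)`, summed from the left, starting at the neutral element `(0, 1)`. -/
def trace {K : Type*} [Field K] (a d : K) (q : ℕ) :
    ℕ → OnePoint K × OnePoint K → OnePoint K × OnePoint K
  | 0, _ => affinePt 0 1
  | n + 1, P => add a d (trace a d q n P) ((frob q)^[n] P)

/-- The trace zero subgroup `𝒯_n`, for `K` the extension of degree `n` of the field with `q`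
elements over which the curve is defined. -/
def traceZero {K : Type*} [Field K] (a d : K) (q n : ℕ) : Set (OnePoint K × OnePoint K) :=
  {P | P ∈ points a d ∧ trace a d q n P = affinePt 0 1}

/-! ### Divisors on the projective closure -/

/-- The homogeneous equation `a X² Z² + Y² Z² - Z⁴ - d X² Y²` of the projective closure of
`E_{a,d}`; the coordinates `X, Y, Z` have the indices `0, 1, 2`. -/
def curveForm {k : Type*} [Field k] (a d : k) : MvPolynomial (Fin 3) k :=
  MvPolynomial.C a * MvPolynomial.X 0 ^ 2 * MvPolynomial.X 2 ^ 2 +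
    MvPolynomial.X 1 ^ 2 * MvPolynomial.X 2 ^ 2 - MvPolynomial.X 2 ^ 4 -
      MvPolynomial.C d * MvPolynomial.X 0 ^ 2 * MvPolynomial.X 1 ^ 2

/-- The homogenization, of degree the total degree of `h`, of a polynomial `h(x, y)`
(where `x = X 0` and `y = X 1`). -/
def homogenization {k : Type*} [Field k] (h : MvPolynomial (Fin 2) k) : MvPolynomial (Fin 3) k :=
  ∑ m ∈ h.support, MvPolynomial.C (h.coeff m) * MvPolynomial.X 0 ^ (m 0) *
    MvPolynomial.X 1 ^ (m 1) * MvPolynomial.X 2 ^ (h.totalDegree - (m 0 + m 1))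

/-- The points of the projective plane at which the curve can pass: the affine points
`[x, y, 1]` and the two points `Ω₁ = [1, 0, 0]` and `Ω₂ = [0, 1, 0]`, which are the only points of
the curve on the line `Z = 0`. -/
inductive PlanePt (k : Type*) where
  | affine (x y : k) : PlanePt k
  | Omega1 : PlanePt k
  | Omega2 : PlanePt k

/-- Dehomogenization in the standard chart around a point: `Z = 1` at an affine point, `X = 1` at
`Ω₁`, `Y = 1` at `Ω₂`. -/
def chart {k : Type*} [Field k] : PlanePt k → MvPolynomial (Fin 3) k →ₐ[k] MvPolynomial (Fin 2) k
  | .affine _ _ => MvPolynomial.aeval ![MvPolynomial.X 0, MvPolynomial.X 1, 1]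
  | .Omega1 => MvPolynomial.aeval ![1, MvPolynomial.X 0, MvPolynomial.X 1]
  | .Omega2 => MvPolynomial.aeval ![MvPolynomial.X 0, 1, MvPolynomial.X 1]

/-- The coordinates of a point in its chart. -/
def coords {k : Type*} [Field k] : PlanePt k → (Fin 2 → k)
  | .affine x y => ![x, y]
  | .Omega1 => ![0, 0]
  | .Omega2 => ![0, 0]

/-- The coordinate ring of the affine part of the curve that lies in the chart around `p`. -/
abbrev ChartRing {k : Type*} [Field k] (a d : k) (p : PlanePt k) : Type _ :=
  MvPolynomial (Fin 2) k ⧸ Ideal.span {chart p (curveForm a d)}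

/-- The classes of the polynomials that do not vanish at `p`. -/
def nonvanishing {k : Type*} [Field k] (a d : k) (p : PlanePt k) : Submonoid (ChartRing a d p) :=
  ((nonZeroDivisors k).comap (MvPolynomial.eval (coords p))).map
    (Ideal.Quotient.mk (Ideal.span {chart p (curveForm a d)}))

/-- The local ring of the projective closure of `E_{a,d}` at `p` (the zero ring if `p` does not lie
on the curve). -/
abbrev LocalRing {k : Type*} [Field k] (a d : k) (p : PlanePt k) : Type _ :=
  Localization (nonvanishing a d p)

/-- The intersection multiplicity at `p` of the curve with the form `G`: the length of `𝒪_p / (G)`,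
where `𝒪_p` is the local ring of the curve at `p`. -/
def mult {k : Type*} [Field k] (a d : k) (G : MvPolynomial (Fin 3) k) (p : PlanePt k) : ℕ∞ :=
  Ring.ord (LocalRing a d p)
    (algebraMap (ChartRing a d p) (LocalRing a d p)
      (Ideal.Quotient.mk (Ideal.span {chart p (curveForm a d)}) (chart p G)))

/-- The divisor, on the projective closure of `E_{a,d}`, of the homogeneous rational function
`H(X, Y, Z) / Z ^ deg h` associated with a polynomial function `h(x, y)`.  It is meant for
`k` algebraically closed and `h` not divisible by the equation of the curve. -/
def divisor {k : Type*} [Field k] (a d : k) (h : MvPolynomial (Fin 2) k) (p : PlanePt k) : ℤ :=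
  ((mult a d (homogenization h) p).toNat : ℤ) -
    (h.totalDegree : ℤ) * ((mult a d (MvPolynomial.X 2) p).toNat : ℤ)

/-! ### The polynomials `q_P` and `Q_P` -/

/-- The polynomial `(1 + y) q̂₁(y) + x q₂(y)` in two variables `x = X 0` and `y = X 1`. -/
def qPoly {F : Type*} [Field F] (qhat₁ q₂ : Polynomial F) : MvPolynomial (Fin 2) F :=
  (1 + MvPolynomial.X 1) * Polynomial.aeval (MvPolynomial.X 1) qhat₁ +
    MvPolynomial.X 0 * Polynomial.aeval (MvPolynomial.X 1) q₂

/-- `Q(y) = (a - d y²) (1 + y) q̂₁(y)² + (y - 1) q₂(y)²`. -/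
def QPoly {F : Type*} [Field F] (a d : F) (qhat₁ q₂ : Polynomial F) : Polynomial F :=
  (Polynomial.C a - Polynomial.C d * Polynomial.X ^ 2) * (1 + Polynomial.X) * qhat₁ ^ 2 +
    (Polynomial.X - 1) * q₂ ^ 2

/-- The divisor `P + φ(P) + ⋯ + φ^{n-1}(P) + 𝒪' - 2 Ω₁ - (n - 1) Ω₂` for `P = (u, v)`,
where `𝒪' = (0, -1)`. -/
def conjDivisor {k : Type*} [Field k] (q n : ℕ) (u v : k) : PlanePt k →₀ ℤ :=
  ∑ i ∈ Finset.range n, Finsupp.single (PlanePt.affine (u ^ q ^ i) (v ^ q ^ i)) 1 +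
    Finsupp.single (PlanePt.affine 0 (-1)) 1 - Finsupp.single PlanePt.Omega1 2 -
      Finsupp.single PlanePt.Omega2 ((n : ℤ) - 1)

end

end TwistedEdwards

namespace TwistedEdwards

noncomputable section

open scoped Classical

/-! ### Orders of vanishing in commutative rings -/

/-! On the curve `x² (a - d y²) = 1 - y²`, so the norm of `q_P` under `x ↦ -x` satisfies `(a - d y²)
· q_P(x, y) · q_P(-x, y) = (1 + y) · Q_P(y)`. The roots of `Q_P` are read off by comparing orders of
vanishing of the two sides, in the local rings of the curve over the algebraic closure.

At an affine point `a - d y²` is a unit. Hence the multiplicities of `q_P` at `(x, y)` and `(-x, y)`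
add up to the multiplicity of `y` as a root of `(1 + Y) Q_P`, doubled when `x = 0`, where `y` is
ramified (`mult_affine_add_mult_neg`). The summand `𝒪'` of the divisor accounts for the factor `1 +
Y`, and what remains are the `y`-coordinates of the conjugates of `P`.

Affine points cannot detect a root `r` of `Q_P` with `a - d r² = 0`; the order at `Ω₁` excludes it.
There the line `Y = r Z` has multiplicity 2 in general and 4 if `a - d r² = 0`, when it is tangent
to a branch. The homogenized norm relation (`germ_Omega1_norm`) turns the coefficient `-2` at `Ω₁`
into the statement that these multiplicities sum to twice the number of roots, so no tangent line
occurs.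

The point `Ω₁` is singular, so its local ring carries no valuation to use. The order is the length
of a quotient instead, which is additive on nonzerodivisors; hence the lemmas that certify
nonzerodivisors. -/

theorem ord_ringEquiv {R S : Type*} [CommRing R] [CommRing S] (e : R ≃+* S) (x : R) :
    Ring.ord S (e x) = Ring.ord R x := by
  rw [Ring.ord, Ring.ord, Module.length_quotient, Module.length_quotient,
    ← Order.coheight_orderIso e.idealComapOrderIso]
  congr 1
  change Ideal.comap e (Ideal.span {e x}) = _
  rw [← Ideal.map_symm, Ideal.map_span]
  simp

theorem ord_of_isUnit {R : Type*} [CommRing R] {x : R} (hx : IsUnit x) : Ring.ord R x = 0 := by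
  rw [Ring.ord, Ideal.span_singleton_eq_top.mpr hx]
  exact Module.length_eq_zero_iff.mpr (Ideal.Quotient.subsingleton_iff.mpr rfl)

theorem ord_of_span_isMaximal {R : Type*} [CommRing R] {x : R}
    (hx : (Ideal.span {x}).IsMaximal) : Ring.ord R x = 1 := by
  rw [Ring.ord, Module.length_eq_one_iff]
  exact isSimpleModule_iff_isCoatom.mpr hx.out

/-- Adjoining to an ideal an element killed by a maximal ideal lowers the colength by one. -/
theorem length_quotient_eq_add_one {R : Type*} [CommRing R] {m J J' : Ideal R} (hm : m.IsMaximal)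
    {s : R} (hJ : J = J' ⊔ Ideal.span {s}) (hs : s ∉ J') (hms : ∀ x ∈ m, x * s ∈ J') :
    Module.length R (R ⧸ J') = Module.length R (R ⧸ J) + 1 := by
  have hle : J' ≤ J := hJ ▸ le_sup_left
  -- Multiplication by `s` identifies `R ⧸ m` with the kernel `J / J'` of the projection. It is
  -- injective because the annihilator of `s` modulo `J'` is a proper ideal containing the maximal
  -- ideal `m`.
  let f : (R ⧸ m) →ₗ[R] (R ⧸ J') := Submodule.mapQ m J' (LinearMap.mulRight R s) hms
  let g : (R ⧸ J') →ₗ[R] (R ⧸ J) := Submodule.factor hle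
  have hcomap : Submodule.comap (LinearMap.mulRight R s) J' = m := by
    refine (hm.eq_of_le ?_ hms).symm
    rw [Ne, Ideal.eq_top_iff_one]
    simpa using hs
  have hf : Function.Injective f := by
    rw [← LinearMap.ker_eq_bot]
    refine Submodule.ker_liftQ_eq_bot _ _ _ ?_
    rw [LinearMap.ker_comp, Submodule.ker_mkQ, hcomap]
  have hg : Function.Surjective g := Submodule.factor_surjective hle
  have hex : Function.Exact f g := by
    intro z
    obtain ⟨z, rfl⟩ := Submodule.Quotient.mk_surjective _ z
    constructor
    · intro hz
      have hz' : z ∈ J := (Submodule.Quotient.mk_eq_zero J).mp hz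
      rw [hJ, Submodule.mem_sup] at hz'
      obtain ⟨u, hu, v, hv, rfl⟩ := hz'
      obtain ⟨c, rfl⟩ := Ideal.mem_span_singleton'.mp hv
      refine ⟨Submodule.Quotient.mk c, ?_⟩
      refine (Submodule.Quotient.eq J').mpr ?_
      simpa using hu
    · rintro ⟨c, hc⟩
      obtain ⟨c, rfl⟩ := Submodule.Quotient.mk_surjective _ c
      rw [← hc]
      refine (Submodule.Quotient.mk_eq_zero J).mpr ?_
      rw [hJ]
      exact Ideal.mem_sup_right (Ideal.mem_span_singleton'.mpr ⟨c, rfl⟩)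
  rw [Module.length_eq_add_of_exact f g hf hg hex, add_comm,
    Module.length_eq_one_iff.mpr (isSimpleModule_iff_isCoatom.mpr hm.out)]

/-- The colength of `(l, t ^ e)` when `(l, t)` is maximal and the powers of `t` up to `t ^ e` are
distinguished modulo `l`. -/
theorem length_quotient_pow {R : Type*} [CommRing R] {l t : R}
    (hm : (Ideal.span {l} ⊔ Ideal.span {t}).IsMaximal) (e : ℕ)
    (ht : ∀ j < e, t ^ j ∉ Ideal.span {l} ⊔ Ideal.span {t ^ (j + 1)}) :
    Module.length R (R ⧸ (Ideal.span {l} ⊔ Ideal.span {t ^ e})) = e := by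
  induction e with
  | zero =>
    refine Module.length_eq_zero_iff.mpr (Ideal.Quotient.subsingleton_iff.mpr ?_)
    simp
  | succ e ih =>
    rw [length_quotient_eq_add_one (J := Ideal.span {l} ⊔ Ideal.span {t ^ e}) (s := t ^ e) hm ?_
      (ht e (Nat.lt_succ_self e)) ?_, ih fun j hj => ht j (hj.trans (Nat.lt_succ_self e))]
    · simp
    · rw [sup_assoc, sup_of_le_right (a := Ideal.span {t ^ (e + 1)})]
      rw [Ideal.span_singleton_le_span_singleton]
      exact pow_dvd_pow t (Nat.le_succ e)
    · intro x hx
      obtain ⟨u, hu, v, hv, rfl⟩ := Submodule.mem_sup.mp hx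
      obtain ⟨c, rfl⟩ := Ideal.mem_span_singleton'.mp hv
      rw [add_mul]
      refine add_mem (Ideal.mem_sup_left (Ideal.mul_mem_right _ _ hu)) (Ideal.mem_sup_right ?_)
      exact Ideal.mem_span_singleton'.mpr ⟨c, by ring⟩

/-- Orders add only over nonzerodivisors, so that property is carried through the same induction. -/
theorem ord_multiset_prod {ι R : Type*} [CommRing R] (f : ι → R) (s : Multiset ι)
    (hf : ∀ i ∈ s, f i ∈ nonZeroDivisors R) :
    (s.map f).prod ∈ nonZeroDivisors R ∧
      Ring.ord R (s.map f).prod = (s.map fun i => Ring.ord R (f i)).sum := by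
  induction s using Multiset.induction with
  | empty => simp
  | cons i s ih =>
    obtain ⟨h₁, h₂⟩ := ih fun j hj => hf j (Multiset.mem_cons_of_mem hj)
    have hi := hf i (Multiset.mem_cons_self i s)
    simp only [Multiset.map_cons, Multiset.prod_cons, Multiset.sum_cons]
    exact ⟨mul_mem hi h₁, by rw [Ring.ord_mul R h₁, h₂]⟩

/-! ### The local rings of the curve -/

section LocalRing

variable {k : Type*} [Field k] {a d : k} {p : PlanePt k}

/-- The local ring of the curve at `p`, with its structure of a commutative ring as the only one
visible to instance search. -/
def Germ (a d : k) (p : PlanePt k) : Type _ := LocalRing a d p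

instance : CommRing (Germ a d p) := inferInstanceAs (CommRing (Localization (nonvanishing a d p)))

instance : Algebra (ChartRing a d p) (Germ a d p) :=
  inferInstanceAs (Algebra (ChartRing a d p) (Localization (nonvanishing a d p)))

instance : IsLocalization (nonvanishing a d p) (Germ a d p) :=
  inferInstanceAs (IsLocalization (nonvanishing a d p) (Localization (nonvanishing a d p)))

/-- The germ at `p` of a polynomial in the coordinates of the chart around `p`. -/
def germ (a d : k) (p : PlanePt k) : MvPolynomial (Fin 2) k →+* Germ a d p :=
  (algebraMap (ChartRing a d p) (Germ a d p)).comp (Ideal.Quotient.mk _)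

theorem mult_eq_ord_germ (G : MvPolynomial (Fin 3) k) :
    mult a d G p = Ring.ord (Germ a d p) (germ a d p (chart p G)) := rfl

theorem germ_curve : germ a d p (chart p (curveForm a d)) = 0 := by
  have : Ideal.Quotient.mk (Ideal.span {chart p (curveForm a d)}) (chart p (curveForm a d)) = 0 :=
    Ideal.Quotient.eq_zero_iff_mem.mpr (Ideal.mem_span_singleton_self _)
  rw [germ, RingHom.comp_apply, this, map_zero]

theorem mk_mem_nonvanishing {g : MvPolynomial (Fin 2) k}
    (hg : MvPolynomial.eval (coords p) g ≠ 0) :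
    Ideal.Quotient.mk (Ideal.span {chart p (curveForm a d)}) g ∈ nonvanishing a d p :=
  ⟨g, mem_nonZeroDivisors_of_ne_zero hg, rfl⟩

theorem isUnit_germ {g : MvPolynomial (Fin 2) k} (hg : MvPolynomial.eval (coords p) g ≠ 0) :
    IsUnit (germ a d p g) :=
  IsLocalization.map_units (Germ a d p)
    (⟨_, mk_mem_nonvanishing hg⟩ : nonvanishing a d p)

theorem exists_mul_germ_eq (x : Germ a d p) :
    ∃ f g : MvPolynomial (Fin 2) k, MvPolynomial.eval (coords p) g ≠ 0 ∧
      x * germ a d p g = germ a d p f := by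
  obtain ⟨⟨f, g, g', hg', rfl⟩, h⟩ := IsLocalization.surj (nonvanishing a d p) x
  obtain ⟨f, rfl⟩ := Ideal.Quotient.mk_surjective f
  exact ⟨f, g', nonZeroDivisors.ne_zero hg', h⟩

/-- The universal properties of quotient and localization combined, so that maps out of the local
ring are described on polynomials alone. -/
theorem exists_lift {S : Type*} [CommRing S] (σ : MvPolynomial (Fin 2) k →+* S)
    (hσ : σ (chart p (curveForm a d)) = 0)
    (hu : ∀ g, MvPolynomial.eval (coords p) g ≠ 0 → IsUnit (σ g)) :
    ∃ φ : Germ a d p →+* S, ∀ f, φ (germ a d p f) = σ f := by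
  let σ' : ChartRing a d p →+* S := Ideal.Quotient.lift _ σ (by
    intro f hf
    obtain ⟨c, rfl⟩ := Ideal.mem_span_singleton'.mp hf
    rw [map_mul, hσ, mul_zero])
  have hσ' : ∀ y : nonvanishing a d p, IsUnit (σ' y) := by
    rintro ⟨_, g, hg, rfl⟩
    exact hu g (nonZeroDivisors.ne_zero hg)
  refine ⟨IsLocalization.lift (M := nonvanishing a d p) (S := Germ a d p) hσ', fun f => ?_⟩
  rw [germ, RingHom.comp_apply, IsLocalization.lift_eq]
  rfl

theorem ringHom_ext_germ {S : Type*} [CommRing S] {φ ψ : Germ a d p →+* S}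
    (h : ∀ f, φ (germ a d p f) = ψ (germ a d p f)) : φ = ψ :=
  IsLocalization.ringHom_ext (S := Germ a d p) (nonvanishing a d p)
    (Ideal.Quotient.ringHom_ext (RingHom.ext h))

/-- The order of a germ is invariant under automorphisms of the plane that preserve the curve. -/
theorem ord_germ_ringEquiv {p' : PlanePt k}
    (e : MvPolynomial (Fin 2) k ≃+* MvPolynomial (Fin 2) k)
    (he : e (chart p (curveForm a d)) = chart p' (curveForm a d))
    (hev : ∀ g, MvPolynomial.eval (coords p') (e g) = MvPolynomial.eval (coords p) g)
    (f : MvPolynomial (Fin 2) k) :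
    Ring.ord _ (germ a d p' (e f)) = Ring.ord _ (germ a d p f) := by
  let σ : MvPolynomial (Fin 2) k →+* Germ a d p' := (germ a d p').comp e.toRingHom
  let τ : MvPolynomial (Fin 2) k →+* Germ a d p := (germ a d p).comp e.symm.toRingHom
  have hσ : ∀ g, σ g = germ a d p' (e g) := fun _ => rfl
  have hτ : ∀ g, τ g = germ a d p (e.symm g) := fun _ => rfl
  obtain ⟨φ, hφ⟩ := exists_lift (a := a) (d := d) (p := p) (S := Germ a d p') σ
    (by rw [hσ, he, germ_curve]) (fun g hg => isUnit_germ ((hev g).trans_ne hg))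
  obtain ⟨ψ, hψ⟩ := exists_lift (a := a) (d := d) (p := p') (S := Germ a d p) τ
    (by rw [hτ, ← he, e.symm_apply_apply, germ_curve]) (fun g hg => isUnit_germ (by
      rw [← hev]
      exact (congrArg _ (e.apply_symm_apply g)).trans_ne hg))
  have h₁ : φ.comp ψ = RingHom.id _ := ringHom_ext_germ (by simp [hφ, hψ, hσ, hτ])
  have h₂ : ψ.comp φ = RingHom.id _ := ringHom_ext_germ (by simp [hφ, hψ, hσ, hτ])
  have := ord_ringEquiv (RingEquiv.ofRingHom φ ψ h₁ h₂) (germ a d p f)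
  rwa [RingEquiv.ofRingHom_apply, hφ, hσ] at this

/-- The equation `l` of a rational curve parametrized by `σ` is a nonzerodivisor on the curve if the
parametrized curve does not lie on it. -/
theorem germ_mem_nonZeroDivisors {l : MvPolynomial (Fin 2) k}
    (σ : MvPolynomial (Fin 2) k →ₐ[k] Polynomial k)
    (ι : Polynomial k →ₐ[k] MvPolynomial (Fin 2) k) (hl0 : l ≠ 0) (hl : σ l = 0)
    (hι : ∀ i, l ∣ MvPolynomial.X i - ι (σ (MvPolynomial.X i)))
    (hσ : σ (chart p (curveForm a d)) ≠ 0) : germ a d p l ∈ nonZeroDivisors (Germ a d p) := by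
  -- Modulo `l` the identity factors through `σ`, so the kernel of `σ` is generated by `l`.
  have hdvd : ∀ f, σ f = 0 → l ∣ f := by
    have : Ideal.Quotient.mkₐ k (Ideal.span {l}) =
        (Ideal.Quotient.mkₐ k (Ideal.span {l})).comp (ι.comp σ) :=
      MvPolynomial.algHom_ext fun i =>
        Ideal.Quotient.eq.mpr (Ideal.mem_span_singleton.mpr (hι i))
    intro f hf
    have h := DFunLike.congr_fun this f
    rw [AlgHom.comp_apply, AlgHom.comp_apply, hf, map_zero, map_zero] at h
    exact Ideal.mem_span_singleton.mp (Ideal.Quotient.eq_zero_iff_mem.mp h)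
  have hF : chart p (curveForm a d) ≠ 0 := fun h => hσ (by rw [h, map_zero])
  refine IsLocalization.map_nonZeroDivisors_le (nonvanishing a d p) (Germ a d p)
    ⟨Ideal.Quotient.mk _ l, ?_, rfl⟩
  refine mem_nonZeroDivisors_iff_right.mpr fun x hx => ?_
  obtain ⟨x, rfl⟩ := Ideal.Quotient.mk_surjective x
  rw [← map_mul, Ideal.Quotient.eq_zero_iff_mem, Ideal.mem_span_singleton] at hx
  obtain ⟨c, hc⟩ := hx
  have hc0 : σ c = 0 := by
    have := congrArg σ hc
    rw [map_mul, map_mul, hl, mul_zero] at this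
    exact (mul_eq_zero.mp this.symm).resolve_left hσ
  obtain ⟨b, rfl⟩ := hdvd c hc0
  rw [Ideal.Quotient.eq_zero_iff_mem, Ideal.mem_span_singleton]
  exact ⟨b, mul_right_cancel₀ hl0 (by rw [hc]; ring)⟩

theorem germ_eq_germ_of_sub_eq {f g : MvPolynomial (Fin 2) k} (c : MvPolynomial (Fin 2) k)
    (h : f - g = c * chart p (curveForm a d)) : germ a d p f = germ a d p g := by
  rw [← sub_eq_zero, ← map_sub, h, map_mul, germ_curve, mul_zero]

theorem ord_mul_of_isUnit {R : Type*} [CommRing R] {u x : R} (hu : IsUnit u) :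
    Ring.ord R (u * x) = Ring.ord R x := by
  rw [Ring.ord_mul' R hu.mem_nonZeroDivisors, ord_of_isUnit hu, zero_add]

/-- A proper ideal of the local ring that contains the coordinate functions is maximal. -/
theorem isMaximal_of_germ_mem {I : Ideal (Germ a d p)} (hI : I ≠ ⊤)
    (h : ∀ i, germ a d p (MvPolynomial.X i - MvPolynomial.C (coords p i)) ∈ I) : I.IsMaximal := by
  have hf : ∀ f, germ a d p (f - MvPolynomial.C (MvPolynomial.eval (coords p) f)) ∈ I := by
    intro f
    have : (Ideal.Quotient.mk I).comp (germ a d p) =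
        ((Ideal.Quotient.mk I).comp (germ a d p)).comp
          (MvPolynomial.C.comp (MvPolynomial.eval (coords p))) := by
      refine MvPolynomial.ringHom_ext (fun r => by simp) fun i => ?_
      refine Ideal.Quotient.eq.mpr ?_
      rw [← map_sub]
      simpa using h i
    rw [map_sub]
    exact Ideal.Quotient.eq.mp (DFunLike.congr_fun this f)
  refine Ideal.isMaximal_def.mpr ⟨hI, fun J hJ => ?_⟩
  obtain ⟨x, hxJ, hxI⟩ := Set.exists_of_ssubset hJ
  obtain ⟨f, g, hg, hx⟩ := exists_mul_germ_eq x
  have hfI : germ a d p f ∉ I := by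
    rwa [← hx, Ideal.mul_unit_mem_iff_mem _ (isUnit_germ hg)]
  have hf0 : MvPolynomial.eval (coords p) f ≠ 0 := fun h0 => hfI (by simpa [h0] using hf f)
  exact Ideal.eq_top_of_isUnit_mem J (hx ▸ Ideal.mul_mem_right _ J hxJ) (isUnit_germ hf0)

/-- Evaluation at a point of the curve; it serves to show that ideals generated by functions
vanishing there are proper. -/
theorem exists_eval_hom (hp : MvPolynomial.eval (coords p) (chart p (curveForm a d)) = 0) :
    ∃ φ : Germ a d p →+* k, ∀ f, φ (germ a d p f) = MvPolynomial.eval (coords p) f :=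
  exists_lift _ hp fun _ hg => hg.isUnit

/-! ### Contact of the curve with a parametrized line -/

section Param

variable {l t : MvPolynomial (Fin 2) k} (σ : MvPolynomial (Fin 2) k →ₐ[k] Polynomial k) {e : ℕ}

/-- If the line parametrized by `σ` meets the curve to order at least `e`, then `σ` induces a map
from the local ring to `k⟦X⟧ / (X ^ e)`. It kills `l` and sends `t` to `X`, and there `X ^ j` is not
a multiple of `X ^ (j + 1)` for `j < e`. -/
theorem germ_pow_notMem (hσ0 : ∀ i, (σ (MvPolynomial.X i)).eval 0 = coords p i) (hl : σ l = 0)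
    (ht : σ t = Polynomial.X) (hF : Polynomial.X ^ e ∣ σ (chart p (curveForm a d)))
    {j : ℕ} (hj : j < e) :
    germ a d p t ^ j ∉ Ideal.span {germ a d p l} ⊔ Ideal.span {germ a d p t ^ (j + 1)} := by
  let I : Ideal (PowerSeries k) := Ideal.span {PowerSeries.X ^ e}
  let τ : MvPolynomial (Fin 2) k →+* PowerSeries k ⧸ I :=
    (Ideal.Quotient.mk I).comp (Polynomial.coeToPowerSeries.ringHom.comp (σ : _ →+* _))
  have hτ : ∀ f, τ f = Ideal.Quotient.mk I (σ f : PowerSeries k) := fun _ => rfl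
  have hev : ∀ g, (σ g).eval 0 = MvPolynomial.eval (coords p) g := by
    intro g
    have : (Polynomial.evalRingHom 0).comp (σ : _ →+* _) = MvPolynomial.eval (coords p) :=
      MvPolynomial.ringHom_ext (fun r => by simp [MvPolynomial.algHom_C]) fun i => by
        simpa using hσ0 i
    exact DFunLike.congr_fun this g
  obtain ⟨φ, hφ⟩ := exists_lift (a := a) (d := d) (p := p) τ (by
    obtain ⟨c, hc⟩ := hF
    rw [hτ, hc, Ideal.Quotient.eq_zero_iff_mem, Ideal.mem_span_singleton]
    exact ⟨c, by simp⟩) (fun g hg => by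
      rw [hτ]
      refine IsUnit.map _ (PowerSeries.isUnit_iff_constantCoeff.mpr ?_)
      rw [← PowerSeries.coeff_zero_eq_constantCoeff_apply, Polynomial.coeff_coe,
        Polynomial.coeff_zero_eq_eval_zero, hev]
      exact hg.isUnit)
  intro hmem
  obtain ⟨x, hx, y, hy, hxy⟩ := Submodule.mem_sup.mp hmem
  obtain ⟨x, rfl⟩ := Ideal.mem_span_singleton'.mp hx
  obtain ⟨y, rfl⟩ := Ideal.mem_span_singleton'.mp hy
  have h := congrArg φ hxy
  rw [map_add, map_mul, map_mul, map_pow, map_pow, hφ, hφ, hτ, hτ, hl, ht] at h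
  obtain ⟨y', hy'⟩ := Ideal.Quotient.mk_surjective (φ y)
  rw [← hy', Polynomial.coe_X, Polynomial.coe_zero, map_zero, mul_zero, zero_add, ← map_pow,
    ← map_pow, ← map_mul] at h
  have h' := Ideal.mem_span_singleton.mp (Ideal.Quotient.eq.mp h)
  have hdvd : (PowerSeries.X : PowerSeries k) ^ (j + 1) ∣ PowerSeries.X ^ j :=
    (dvd_sub_right (Dvd.intro_left y' rfl)).mp ((pow_dvd_pow _ hj).trans h')
  have := PowerSeries.X_pow_dvd_iff.mp hdvd j (Nat.lt_succ_self j)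
  simp at this

theorem length_quotient_germ_pow (hσ0 : ∀ i, (σ (MvPolynomial.X i)).eval 0 = coords p i)
    (hl : σ l = 0) (ht : σ t = Polynomial.X)
    (hF : Polynomial.X ^ e ∣ σ (chart p (curveForm a d))) (he : 0 < e)
    (hm : ∀ i, MvPolynomial.X i - MvPolynomial.C (coords p i) ∈ Ideal.span {l, t}) :
    Module.length (Germ a d p) (Germ a d p ⧸
      (Ideal.span {germ a d p l} ⊔ Ideal.span {germ a d p t ^ e})) = e := by
  refine length_quotient_pow ?_ e fun j hj => germ_pow_notMem σ hσ0 hl ht hF hj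
  refine isMaximal_of_germ_mem (fun h => ?_) fun i => ?_
  · refine germ_pow_notMem (a := a) (d := d) (p := p) σ hσ0 hl ht hF he ?_
    rw [zero_add, pow_one, h]
    exact Submodule.mem_top
  · have := Ideal.mem_map_of_mem (germ a d p) (hm i)
    rwa [Ideal.map_span, Set.image_pair, Ideal.span_insert] at this

/-- The contact order along the parametrized line bounds the length from below; the divisibility
`hte`, which puts `t ^ e` in the ideal of `l`, bounds it from above. -/
theorem ord_germ_eq (hσ0 : ∀ i, (σ (MvPolynomial.X i)).eval 0 = coords p i)
    (hl : σ l = 0) (ht : σ t = Polynomial.X)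
    (hF : Polynomial.X ^ e ∣ σ (chart p (curveForm a d))) (he : 0 < e)
    (hm : ∀ i, MvPolynomial.X i - MvPolynomial.C (coords p i) ∈ Ideal.span {l, t})
    (hte : germ a d p l ∣ germ a d p t ^ e) :
    Ring.ord _ (germ a d p l) = e := by
  rw [← length_quotient_germ_pow σ hσ0 hl ht hF he hm, sup_eq_left.mpr, Ring.ord]
  rwa [Ideal.span_singleton_le_span_singleton]

end Param

end LocalRing

/-! ### Homogenization -/

/-- This is `H(x, y, z) = z ^ m · h(x / z, y / z)`, with `w` in the role of `1 / z`. -/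
theorem aeval_homogenization {k S : Type*} [Field k] [CommRing S] [Algebra k S]
    (h : MvPolynomial (Fin 2) k) (x y z w : S) (hw : z * w = 1) :
    MvPolynomial.aeval ![x, y, z] (homogenization h) =
      z ^ h.totalDegree * MvPolynomial.aeval ![x * w, y * w] h := by
  rw [homogenization, map_sum, MvPolynomial.aeval_def, MvPolynomial.eval₂_eq', Finset.mul_sum]
  refine Finset.sum_congr rfl fun m hm => ?_
  have hdeg : m 0 + m 1 ≤ h.totalDegree := by
    simpa [Finsupp.sum_fintype] using MvPolynomial.le_totalDegree hm
  obtain ⟨j, hj⟩ := Nat.exists_eq_add_of_le hdeg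
  rw [hj, Nat.add_sub_cancel_left]
  simp only [map_mul, map_pow, MvPolynomial.aeval_C, MvPolynomial.aeval_X, Fin.prod_univ_two,
    Matrix.cons_val_zero, Matrix.cons_val_one, Matrix.cons_val]
  have : z ^ (m 0 + m 1) * (w ^ m 0 * w ^ m 1) = 1 := by
    rw [← pow_add, ← mul_pow, hw, one_pow]
  rw [mul_pow, mul_pow, pow_add]
  linear_combination (- algebraMap k S (h.coeff m) * x ^ m 0 * y ^ m 1 * z ^ j) * this

/-! ### The polynomials `q_P` and `Q_P` -/

theorem aeval_qPoly {k S : Type*} [Field k] [CommRing S] [Algebra k S] (q₁ q₂ : Polynomial k)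
    (x y : S) : MvPolynomial.aeval ![x, y] (qPoly q₁ q₂) =
      (1 + y) * Polynomial.aeval y q₁ + x * Polynomial.aeval y q₂ := by
  simp [qPoly, ← Polynomial.aeval_algHom_apply]

theorem aeval_QPoly {k S : Type*} [Field k] [CommRing S] [Algebra k S] (a d : k)
    (q₁ q₂ : Polynomial k) (y : S) : Polynomial.aeval y (QPoly a d q₁ q₂) =
      (algebraMap k S a - algebraMap k S d * y ^ 2) * (1 + y) * Polynomial.aeval y q₁ ^ 2 +
        (y - 1) * Polynomial.aeval y q₂ ^ 2 := by
  simp [QPoly]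

theorem map_qPoly {F k : Type*} [Field F] [Field k] (φ : F →+* k) (q₁ q₂ : Polynomial F) :
    MvPolynomial.map φ (qPoly q₁ q₂) = qPoly (q₁.map φ) (q₂.map φ) := by
  have : ∀ p : Polynomial F, MvPolynomial.map φ (Polynomial.aeval (MvPolynomial.X 1) p) =
      Polynomial.aeval (MvPolynomial.X (1 : Fin 2)) (p.map φ) := by
    intro p
    induction p using Polynomial.induction_on' with
    | add p q hp hq => simp [hp, hq]
    | monomial n r => simp [Polynomial.aeval_monomial]
  simp [qPoly, this]

theorem map_QPoly {F k : Type*} [Field F] [Field k] (φ : F →+* k) (a d : F)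
    (q₁ q₂ : Polynomial F) :
    (QPoly a d q₁ q₂).map φ = QPoly (φ a) (φ d) (q₁.map φ) (q₂.map φ) := by
  simp [QPoly]

/-- A parity argument at `y = 1`: the factor `(a - d y²) (1 + y)` takes the value `2 (a - d) ≠ 0`
there, while `y - 1` has a simple zero. The two summands thus vanish to even and to odd order and
cannot cancel. -/
theorem QPoly_ne_zero {k : Type*} [Field k] (h2 : (2 : k) ≠ 0) {a d : k} (had : a ≠ d)
    {q₁ q₂ : Polynomial k} (hq : q₁ ≠ 0 ∨ q₂ ≠ 0) : QPoly a d q₁ q₂ ≠ 0 := by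
  intro h
  obtain ⟨A, hA⟩ : ∃ A : Polynomial k, A =
    (Polynomial.C a - Polynomial.C d * Polynomial.X ^ 2) * (1 + Polynomial.X) := ⟨_, rfl⟩
  obtain ⟨B, hB⟩ : ∃ B : Polynomial k, B = Polynomial.X - 1 := ⟨_, rfl⟩
  rw [QPoly, ← hA, ← hB] at h
  have hA1 : ¬ A.IsRoot 1 := by
    simp [hA, sub_eq_zero, had, one_add_one_eq_two, h2]
  have hA0 : A ≠ 0 := fun h0 => hA1 (by rw [h0]; simp)
  have hB0 : B ≠ 0 := hB ▸ Polynomial.X_sub_C_ne_zero 1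
  have hB1 : Polynomial.rootMultiplicity 1 B = 1 :=
    hB ▸ Polynomial.rootMultiplicity_X_sub_C_self
  have heq : A * q₁ ^ 2 = B * (-1 * q₂ ^ 2) := by linear_combination h
  have h₁ : q₁ ≠ 0 := by
    rintro rfl
    have : q₂ ^ 2 = 0 := by simpa [hB0] using heq.symm
    simp_all
  have h₂ : q₂ ≠ 0 := by
    rintro rfl
    have : q₁ ^ 2 = 0 := by simpa [hA0] using heq
    simp_all
  have hm := congrArg (Polynomial.rootMultiplicity 1) heq
  have hneg : Polynomial.rootMultiplicity 1 (-1 : Polynomial k) = 0 :=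
    Polynomial.rootMultiplicity_eq_zero (by simp)
  rw [Polynomial.rootMultiplicity_mul (mul_ne_zero hA0 (pow_ne_zero 2 h₁)),
    Polynomial.rootMultiplicity_mul (mul_ne_zero hB0 (by simp [h₂])),
    Polynomial.rootMultiplicity_mul (by simp [h₂]), hB1, hneg,
    Polynomial.rootMultiplicity_eq_zero hA1, sq, sq,
    Polynomial.rootMultiplicity_mul (by simp [h₁]),
    Polynomial.rootMultiplicity_mul (by simp [h₂])] at hm
  omega

/-- The automorphism of the affine plane that multiplies the coordinates by signs. -/
def signAut {k : Type*} [Field k] (ε : Fin 2 → k) (hε : ∀ i, ε i * ε i = 1) :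
    MvPolynomial (Fin 2) k ≃ₐ[k] MvPolynomial (Fin 2) k :=
  have h : (MvPolynomial.aeval fun i => MvPolynomial.C (ε i) * MvPolynomial.X i).comp
      (MvPolynomial.aeval fun i => MvPolynomial.C (ε i) * MvPolynomial.X i) =
        AlgHom.id k (MvPolynomial (Fin 2) k) :=
    MvPolynomial.algHom_ext fun i => by
      rw [AlgHom.comp_apply, MvPolynomial.aeval_X, map_mul, MvPolynomial.algHom_C,
        MvPolynomial.aeval_X, ← mul_assoc, MvPolynomial.algebraMap_eq, ← map_mul, hε, map_one,
        one_mul, AlgHom.id_apply]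
  AlgEquiv.ofAlgHom (MvPolynomial.aeval fun i => MvPolynomial.C (ε i) * MvPolynomial.X i)
    (MvPolynomial.aeval fun i => MvPolynomial.C (ε i) * MvPolynomial.X i) h h

theorem signAut_apply {k : Type*} [Field k] (ε : Fin 2 → k) (hε : ∀ i, ε i * ε i = 1)
    (f : MvPolynomial (Fin 2) k) : signAut ε hε f =
      MvPolynomial.aeval (fun i => MvPolynomial.C (ε i) * MvPolynomial.X i) f := rfl

theorem eval_signAut {k : Type*} [Field k] (ε : Fin 2 → k) (hε : ∀ i, ε i * ε i = 1)
    (f : MvPolynomial (Fin 2) k) (c : Fin 2 → k) :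
    MvPolynomial.eval c (signAut ε hε f) = MvPolynomial.eval (fun i => ε i * c i) f := by
  have : (MvPolynomial.eval c).comp (signAut ε hε : _ →+* _) =
      MvPolynomial.eval fun i => ε i * c i :=
    MvPolynomial.ringHom_ext (fun r => by simp [signAut_apply, MvPolynomial.algHom_C])
      fun i => by simp [signAut_apply]
  exact DFunLike.congr_fun this f

theorem sum_map_ite_eq_count {α : Type*} (s : Multiset α) (y : α) (e : ℕ∞) :
    (s.map fun r => if r = y then e else 0).sum = s.count y * e := by
  induction s using Multiset.induction with
  | empty => simp
  | cons r s ih =>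
    rw [Multiset.map_cons, Multiset.sum_cons, ih, Multiset.count_cons]
    by_cases h : r = y
    · simp [h, add_mul, add_comm]
    · simp [h, Ne.symm h]

/-! ### Affine points -/

section Affine

variable {k : Type*} [Field k] {a d x y : k}

theorem chart_affine_curveForm : chart (.affine x y) (curveForm a d) =
    MvPolynomial.C a * MvPolynomial.X 0 ^ 2 + MvPolynomial.X 1 ^ 2 - 1 -
      MvPolynomial.C d * MvPolynomial.X 0 ^ 2 * MvPolynomial.X 1 ^ 2 := by
  simp [chart, curveForm]

theorem germ_affine_y_sub_mem_nonZeroDivisors (had : a ≠ d) (r : k) :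
    germ a d (.affine x y) (MvPolynomial.X 1 - MvPolynomial.C r) ∈ nonZeroDivisors _ := by
  refine germ_mem_nonZeroDivisors
    (MvPolynomial.aeval ![Polynomial.X, Polynomial.C r]) (Polynomial.aeval (MvPolynomial.X 0))
    ?_ (by simp [MvPolynomial.algHom_C]) ?_ ?_
  · intro h
    have := congrArg (MvPolynomial.eval ![0, r + 1]) h
    simp at this
  · intro i
    fin_cases i <;> simp
  · intro h
    rw [chart_affine_curveForm] at h
    have h0 := congrArg (Polynomial.eval 0) h
    have h1 := congrArg (Polynomial.eval 1) h
    simp [MvPolynomial.algHom_C] at h0 h1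
    exact had (by linear_combination h1 + (d - 1) * h0)

theorem germ_affine_x_mem_nonZeroDivisors :
    germ a d (.affine x y) (MvPolynomial.X 0) ∈ nonZeroDivisors _ := by
  refine germ_mem_nonZeroDivisors
    (MvPolynomial.aeval ![0, Polynomial.X]) (Polynomial.aeval (MvPolynomial.X 1))
    (MvPolynomial.X_ne_zero 0) (by simp) ?_ ?_
  · intro i
    fin_cases i <;> simp
  · intro h
    rw [chart_affine_curveForm] at h
    have h2 := congrArg (fun f => Polynomial.coeff f 2) h
    simp [MvPolynomial.algHom_C, Polynomial.coeff_one] at h2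

theorem eval_coords_affine (hp : a * x ^ 2 + y ^ 2 = 1 + d * x ^ 2 * y ^ 2) :
    MvPolynomial.eval (coords (.affine x y)) (chart (.affine x y) (curveForm a d)) = 0 := by
  simp [chart_affine_curveForm, coords]
  linear_combination hp

/-- The curve equation reads `x² (a - d y²) = 1 - y²`, so `a = d y²` forces `y² = 1` and then `a =
d`. -/
theorem a_sub_ne_zero (had : a ≠ d) (hp : a * x ^ 2 + y ^ 2 = 1 + d * x ^ 2 * y ^ 2) :
    a - d * y ^ 2 ≠ 0 := by
  intro h
  have hy : y ^ 2 = 1 := by linear_combination hp - x ^ 2 * h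
  exact had (by linear_combination h + d * hy)

/-- Away from `x = 0` the function `Y - y` is a uniformizer. Subtracting the equation at the point
from the curve equation gives `(a - d Y²)(X + x)(X - x) = (d x² - 1)(Y + y)(Y - y)`, and the
cofactor of `X - x` is a unit. -/
theorem ord_germ_affine_y_sub_of_ne (h2 : (2 : k) ≠ 0) (had : a ≠ d)
    (hp : a * x ^ 2 + y ^ 2 = 1 + d * x ^ 2 * y ^ 2) (hx : x ≠ 0) :
    Ring.ord _ (germ a d (.affine x y) (MvPolynomial.X 1 - MvPolynomial.C y)) = 1 := by
  obtain ⟨φ, hφ⟩ := exists_eval_hom (eval_coords_affine hp)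
  refine ord_of_span_isMaximal (isMaximal_of_germ_mem ?_ ?_)
  · intro h
    obtain ⟨c, hc⟩ := Ideal.mem_span_singleton'.mp ((Ideal.eq_top_iff_one _).mp h)
    have := congrArg φ hc
    rw [map_mul, hφ] at this
    simp [coords] at this
  · intro i
    fin_cases i
    · have hu : IsUnit (germ a d (.affine x y)
          ((MvPolynomial.C a - MvPolynomial.C d * MvPolynomial.X 1 ^ 2) *
            (MvPolynomial.X 0 + MvPolynomial.C x))) := by
        refine isUnit_germ ?_
        simpa [coords, ← two_mul, h2, hx] using a_sub_ne_zero had hp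
      refine (Ideal.unit_mul_mem_iff_mem _ hu).mp ?_
      have hrel : germ a d (.affine x y)
          (((MvPolynomial.C a - MvPolynomial.C d * MvPolynomial.X 1 ^ 2) *
            (MvPolynomial.X 0 + MvPolynomial.C x)) * (MvPolynomial.X 0 - MvPolynomial.C x)) =
          germ a d (.affine x y) ((MvPolynomial.C (d * x ^ 2 - 1) *
            (MvPolynomial.X 1 + MvPolynomial.C y)) * (MvPolynomial.X 1 - MvPolynomial.C y)) := by
        refine germ_eq_germ_of_sub_eq 1 ?_
        have := congrArg (MvPolynomial.C (σ := Fin 2)) hp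
        simp only [map_add, map_mul, map_pow, map_one] at this
        simp only [chart_affine_curveForm, map_sub, map_mul, map_pow, map_one]
        linear_combination -this
      rw [← map_mul]
      change germ a d (.affine x y) (_ * (MvPolynomial.X 0 - MvPolynomial.C x)) ∈ _
      rw [hrel, map_mul]
      exact Ideal.mul_mem_left _ _ (Ideal.mem_span_singleton_self _)
    · exact Ideal.mem_span_singleton_self _

/-- At `(0, ±1)` the uniformizer is `X`, and `(Y + y)(Y - y) = (d Y² - a) X²` with unit cofactors,
so `Y - y` vanishes doubly. -/
theorem ord_germ_affine_y_sub_of_eq_zero (h2 : (2 : k) ≠ 0) (had : a ≠ d) (hy : y ^ 2 = 1) :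
    Ring.ord _ (germ a d (.affine 0 y) (MvPolynomial.X 1 - MvPolynomial.C y)) = 2 := by
  have hp : a * 0 ^ 2 + y ^ 2 = 1 + d * 0 ^ 2 * y ^ 2 := by simp [hy]
  have hy0 : y ≠ 0 := by rintro rfl; simp at hy
  have hC : (MvPolynomial.C y : MvPolynomial (Fin 2) k) ^ 2 = 1 := by
    rw [← map_pow, hy, map_one]
  obtain ⟨φ, hφ⟩ := exists_eval_hom (eval_coords_affine hp)
  have hu₁ : IsUnit (germ a d (.affine 0 y) (MvPolynomial.X 1 + MvPolynomial.C y)) :=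
    isUnit_germ (by simp [coords, ← two_mul, h2, hy0])
  have hu₂ : IsUnit (germ a d (.affine 0 y)
      (MvPolynomial.C d * MvPolynomial.X 1 ^ 2 - MvPolynomial.C a)) :=
    isUnit_germ (by simp [coords, hy, sub_eq_zero, had.symm])
  have hrel : germ a d (.affine 0 y) (MvPolynomial.X 1 + MvPolynomial.C y) *
      germ a d (.affine 0 y) (MvPolynomial.X 1 - MvPolynomial.C y) =
      germ a d (.affine 0 y) (MvPolynomial.C d * MvPolynomial.X 1 ^ 2 - MvPolynomial.C a) *
        germ a d (.affine 0 y) (MvPolynomial.X 0) ^ 2 := by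
    rw [← map_pow, ← map_mul, ← map_mul]
    refine germ_eq_germ_of_sub_eq 1 ?_
    rw [chart_affine_curveForm]
    linear_combination -hC
  have hord : Ring.ord _ (germ a d (.affine 0 y) (MvPolynomial.X 0)) = 1 := by
    refine ord_of_span_isMaximal (isMaximal_of_germ_mem ?_ ?_)
    · intro h
      obtain ⟨c, hc⟩ := Ideal.mem_span_singleton'.mp ((Ideal.eq_top_iff_one _).mp h)
      have := congrArg φ hc
      rw [map_mul, hφ] at this
      simp [coords] at this
    · intro i
      fin_cases i
      · simp [coords]
      · refine (Ideal.unit_mul_mem_iff_mem _ hu₁).mp ?_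
        refine hrel ▸ Ideal.mul_mem_left _ _ ?_
        rw [sq]
        exact Ideal.mul_mem_left _ _ (Ideal.mem_span_singleton_self _)
  rw [← ord_mul_of_isUnit hu₁, hrel, ord_mul_of_isUnit hu₂,
    Ring.ord_pow germ_affine_x_mem_nonZeroDivisors, hord]
  simp

/-- The order at an affine point of a polynomial in `y`. -/
theorem ord_germ_affine_aeval_y [IsAlgClosed k] (h2 : (2 : k) ≠ 0) (had : a ≠ d)
    (hp : a * x ^ 2 + y ^ 2 = 1 + d * x ^ 2 * y ^ 2) {P : Polynomial k} (hP : P ≠ 0) :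
    germ a d (.affine x y) (Polynomial.aeval (MvPolynomial.X 1) P) ∈ nonZeroDivisors _ ∧
    Ring.ord _ (germ a d (.affine x y) (Polynomial.aeval (MvPolynomial.X 1) P)) =
      P.roots.count y * if x = 0 then 2 else 1 := by
  have hprod : germ a d (.affine x y) (Polynomial.aeval (MvPolynomial.X 1) P) =
      germ a d (.affine x y) (MvPolynomial.C P.leadingCoeff) *
        (P.roots.map fun r =>
          germ a d (.affine x y) (MvPolynomial.X 1 - MvPolynomial.C r)).prod := by
    conv_lhs => rw [(IsAlgClosed.splits P).eq_prod_roots]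
    rw [map_mul, map_mul, map_multiset_prod, map_multiset_prod, Multiset.map_map, Multiset.map_map]
    simp [MvPolynomial.algebraMap_eq, Function.comp_def]
  have hu : IsUnit (germ a d (.affine x y) (MvPolynomial.C P.leadingCoeff)) :=
    isUnit_germ (by simpa using hP)
  have hord : ∀ r, Ring.ord _ (germ a d (.affine x y) (MvPolynomial.X 1 - MvPolynomial.C r)) =
      if r = y then (if x = 0 then 2 else 1) else 0 := by
    intro r
    split_ifs with hr hx
    · subst hr hx
      exact ord_germ_affine_y_sub_of_eq_zero h2 had (by linear_combination hp)
    · subst hr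
      exact ord_germ_affine_y_sub_of_ne h2 had hp hx
    · exact ord_of_isUnit (isUnit_germ (by simpa [coords, sub_eq_zero] using Ne.symm hr))
  obtain ⟨h₁, h₂⟩ := ord_multiset_prod
    (fun r => germ a d (.affine x y) (MvPolynomial.X 1 - MvPolynomial.C r)) P.roots
    fun r _ => germ_affine_y_sub_mem_nonZeroDivisors had r
  rw [hprod]
  refine ⟨mul_mem hu.mem_nonZeroDivisors h₁, ?_⟩
  rw [ord_mul_of_isUnit hu, h₂]
  simp only [hord, sum_map_ite_eq_count]

theorem chart_affine_homogenization (h : MvPolynomial (Fin 2) k) :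
    chart (.affine x y) (homogenization h) = h := by
  have := aeval_homogenization h (MvPolynomial.X 0 : MvPolynomial (Fin 2) k)
    (MvPolynomial.X 1) 1 1 (one_mul 1)
  rw [one_pow, one_mul, mul_one, mul_one] at this
  refine this.trans ?_
  have hX : ![(MvPolynomial.X 0 : MvPolynomial (Fin 2) k), MvPolynomial.X 1] = MvPolynomial.X := by
    ext1 i
    fin_cases i <;> rfl
  rw [hX, MvPolynomial.aeval_X_left_apply]

/-- The multiplicities at opposite points add up to the order of the norm. -/
theorem mult_affine_add_mult_neg [IsAlgClosed k] (h2 : (2 : k) ≠ 0) (had : a ≠ d)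
    (hp : a * x ^ 2 + y ^ 2 = 1 + d * x ^ 2 * y ^ 2) {q₁ q₂ : Polynomial k}
    (hQ : QPoly a d q₁ q₂ ≠ 0) :
    mult a d (homogenization (qPoly q₁ q₂)) (.affine x y) +
      mult a d (homogenization (qPoly q₁ q₂)) (.affine (-x) y) =
    (((1 + Polynomial.X) * QPoly a d q₁ q₂).roots.count y : ℕ∞) * if x = 0 then 2 else 1 := by
  have hε : ∀ i, (![-1, 1] : Fin 2 → k) i * (![-1, 1] : Fin 2 → k) i = 1 := by
    intro i
    fin_cases i <;> simp
  -- The reflection `x ↦ -x` preserves the curve, so the order of `q_P` at `(-x, y)` is the order of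
  -- its conjugate at `(x, y)`.
  have hinv := ord_germ_ringEquiv (a := a) (d := d) (p := .affine (-x) y) (p' := .affine x y)
    (signAut ![-1, 1] hε).toRingEquiv
    (by simp [chart_affine_curveForm, signAut_apply, MvPolynomial.algHom_C])
    (fun g => by
      refine (eval_signAut _ hε g _).trans ?_
      congr 2
      ext i
      fin_cases i <;> simp [coords]) (qPoly q₁ q₂)
  have hX : (1 + Polynomial.X : Polynomial k) ≠ 0 := by
    rw [add_comm]
    exact Polynomial.X_add_C_ne_zero 1
  obtain ⟨h₁, h₂⟩ := ord_germ_affine_aeval_y h2 had hp (mul_ne_zero hX hQ)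
  have hu : IsUnit (germ a d (.affine x y)
      (MvPolynomial.C a - MvPolynomial.C d * MvPolynomial.X 1 ^ 2)) :=
    isUnit_germ (by simpa [coords] using a_sub_ne_zero had hp)
  have hq : qPoly q₁ q₂ = (1 + MvPolynomial.X 1) * Polynomial.aeval (MvPolynomial.X 1) q₁ +
    MvPolynomial.X 0 * Polynomial.aeval (MvPolynomial.X 1) q₂ := rfl
  have hbar : (signAut ![-1, 1] hε).toRingEquiv (qPoly q₁ q₂) =
      (1 + MvPolynomial.X 1) * Polynomial.aeval (MvPolynomial.X 1) q₁ -
        MvPolynomial.X 0 * Polynomial.aeval (MvPolynomial.X 1) q₂ := by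
    simp [hq, signAut_apply, ← Polynomial.aeval_algHom_apply, sub_eq_add_neg]
  -- The norm relation; its two sides differ by `q₂²` times the curve equation.
  have hrel : germ a d (.affine x y) (Polynomial.aeval (MvPolynomial.X 1)
        ((1 + Polynomial.X) * QPoly a d q₁ q₂)) =
      germ a d (.affine x y) (MvPolynomial.C a - MvPolynomial.C d * MvPolynomial.X 1 ^ 2) *
        (germ a d (.affine x y) (qPoly q₁ q₂) * germ a d (.affine x y)
          ((signAut ![-1, 1] hε).toRingEquiv (qPoly q₁ q₂))) := by
    rw [← map_mul, ← map_mul]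
    refine germ_eq_germ_of_sub_eq (Polynomial.aeval (MvPolynomial.X 1) q₂ ^ 2) ?_
    rw [map_mul, aeval_QPoly, chart_affine_curveForm, hbar, hq]
    simp only [map_add, map_one, Polynomial.aeval_X, MvPolynomial.algebraMap_eq]
    ring
  rw [hrel] at h₁ h₂
  rw [ord_mul_of_isUnit hu, Ring.ord_mul _ (mul_mem_nonZeroDivisors.mp
    (mul_mem_nonZeroDivisors.mp h₁).2).2, hinv] at h₂
  rw [← h₂, mult_eq_ord_germ, mult_eq_ord_germ, chart_affine_homogenization,
    chart_affine_homogenization]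

end Affine

/-! ### The point `Ω₁` -/

section Omega

variable {k : Type*} [Field k] {a d : k}

theorem chart_Omega1_curveForm : chart .Omega1 (curveForm a d) =
    MvPolynomial.C a * MvPolynomial.X 1 ^ 2 + MvPolynomial.X 0 ^ 2 * MvPolynomial.X 1 ^ 2 -
      MvPolynomial.X 1 ^ 4 - MvPolynomial.C d * MvPolynomial.X 0 ^ 2 := by
  simp [chart, curveForm]

theorem germ_dvd_germ_of_sub_eq {p : PlanePt k} {f l : MvPolynomial (Fin 2) k}
    (g c : MvPolynomial (Fin 2) k) (h : f - l * g = c * chart p (curveForm a d)) :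
    germ a d p l ∣ germ a d p f :=
  ⟨germ a d p g, by rw [germ_eq_germ_of_sub_eq c h, map_mul]⟩

theorem coords_Omega1 (i : Fin 2) : coords (.Omega1 : PlanePt k) i = 0 := by
  fin_cases i <;> rfl

theorem germ_Omega1_z_mem_nonZeroDivisors (hd : d ≠ 0) :
    germ a d .Omega1 (MvPolynomial.X 1) ∈ nonZeroDivisors _ := by
  refine germ_mem_nonZeroDivisors
    (MvPolynomial.aeval ![Polynomial.X, 0]) (Polynomial.aeval (MvPolynomial.X 0))
    (MvPolynomial.X_ne_zero 1) (by simp) ?_ ?_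
  · intro i
    fin_cases i <;> simp
  · simp [chart_Omega1_curveForm, MvPolynomial.algHom_C, hd]

theorem ord_germ_Omega1_z (hd : d ≠ 0) :
    Ring.ord _ (germ a d .Omega1 (MvPolynomial.X 1)) = 2 := by
  refine ord_germ_eq (t := MvPolynomial.X 0) (e := 2) (MvPolynomial.aeval ![Polynomial.X, 0])
    ?_ (by simp) (by simp) ?_ two_pos ?_ ?_
  · intro i
    fin_cases i <;> simp [coords]
  · simp [chart_Omega1_curveForm, MvPolynomial.algHom_C]
  · intro i
    rw [coords_Omega1, map_zero, sub_zero]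
    fin_cases i
    · exact Ideal.subset_span (by simp)
    · exact Ideal.subset_span (by simp)
  · have hu : IsUnit (germ a d .Omega1 (MvPolynomial.C d)) := isUnit_germ (by simpa using hd)
    refine hu.dvd_mul_left.mp ?_
    rw [← map_pow, ← map_mul]
    refine germ_dvd_germ_of_sub_eq (MvPolynomial.C a * MvPolynomial.X 1 +
      MvPolynomial.X 0 ^ 2 * MvPolynomial.X 1 - MvPolynomial.X 1 ^ 3) (-1) ?_
    rw [chart_Omega1_curveForm]
    ring

/-- The germ at `Ω₁` of the line `Y = r Z`. -/
def lineGerm (a d r : k) : Germ a d .Omega1 :=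
  germ a d .Omega1 (MvPolynomial.X 0 - MvPolynomial.C r * MvPolynomial.X 1)

/-- The coefficient of `X²` decides between contact 2 and contact 4. Both coefficients cannot
vanish, since `r² = 1` together with `a = d r²` would give `a = d`. -/
theorem aeval_line_chart (r : k) :
    MvPolynomial.aeval ![Polynomial.C r * Polynomial.X, Polynomial.X]
      (chart .Omega1 (curveForm a d)) =
    Polynomial.C (a - d * r ^ 2) * Polynomial.X ^ 2 +
      Polynomial.C (r ^ 2 - 1) * Polynomial.X ^ 4 := by
  simp [chart_Omega1_curveForm, MvPolynomial.algHom_C]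
  ring

theorem lineGerm_mem_nonZeroDivisors (had : a ≠ d) (r : k) :
    lineGerm a d r ∈ nonZeroDivisors _ := by
  refine germ_mem_nonZeroDivisors
    (MvPolynomial.aeval ![Polynomial.C r * Polynomial.X, Polynomial.X])
    (Polynomial.aeval (MvPolynomial.X 1)) ?_ ?_ ?_ ?_
  · intro h
    have := congrArg (MvPolynomial.eval ![1, 0]) h
    simp at this
  · simp [MvPolynomial.algHom_C]
  · intro i
    fin_cases i <;> simp [MvPolynomial.algebraMap_eq]
  · rw [aeval_line_chart]
    intro h
    have h2 := congrArg (fun f => Polynomial.coeff f 2) h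
    have h4 := congrArg (fun f => Polynomial.coeff f 4) h
    simp only [Polynomial.coeff_add, Polynomial.coeff_C_mul, Polynomial.coeff_X_pow,
      Polynomial.coeff_zero] at h2 h4
    norm_num at h2 h4
    exact had (by linear_combination h2 + d * h4)

theorem X_sub_C_coords_mem_span_line (r : k) (i : Fin 2) :
    MvPolynomial.X i - MvPolynomial.C (coords (.Omega1 : PlanePt k) i) ∈
      Ideal.span {MvPolynomial.X 0 - MvPolynomial.C r * MvPolynomial.X 1, MvPolynomial.X 1} := by
  rw [coords_Omega1, map_zero, sub_zero, Ideal.mem_span_pair]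
  fin_cases i
  · exact ⟨1, MvPolynomial.C r, by simp⟩
  · exact ⟨0, 1, by simp⟩

theorem ord_lineGerm (r : k) (hr : a - d * r ^ 2 ≠ 0) : Ring.ord _ (lineGerm a d r) = 2 := by
  refine ord_germ_eq (t := MvPolynomial.X 1) (e := 2)
    (MvPolynomial.aeval ![Polynomial.C r * Polynomial.X, Polynomial.X])
    ?_ (by simp [MvPolynomial.algHom_C]) (by simp) ?_ two_pos (X_sub_C_coords_mem_span_line r) ?_
  · intro i
    fin_cases i <;> simp [coords]
  · rw [aeval_line_chart]
    exact dvd_add (dvd_mul_left _ _) ((pow_dvd_pow _ (by norm_num)).trans (dvd_mul_left _ _))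
  · have hu : IsUnit (germ a d .Omega1 (MvPolynomial.C (a - d * r ^ 2) +
        MvPolynomial.C (r ^ 2 - 1) * MvPolynomial.X 1 ^ 2)) :=
      isUnit_germ (by simpa [coords] using hr)
    refine hu.dvd_mul_left.mp ?_
    rw [← map_pow, ← map_mul]
    -- Replacing `Y²` by `r² Z²` in the curve equation costs a multiple of `Y² - r² Z²`; what is
    -- left is `Z²` times the unit above.
    refine germ_dvd_germ_of_sub_eq ((MvPolynomial.C d - MvPolynomial.X 1 ^ 2) *
      (MvPolynomial.X 0 + MvPolynomial.C r * MvPolynomial.X 1)) 1 ?_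
    simp only [chart_Omega1_curveForm, map_sub, map_mul, map_pow, map_one]
    ring

theorem ord_lineGerm_of_tangent (had : a ≠ d) (r : k) (hr : a - d * r ^ 2 = 0) :
    Ring.ord _ (lineGerm a d r) = 4 := by
  refine ord_germ_eq (t := MvPolynomial.X 1) (e := 4)
    (MvPolynomial.aeval ![Polynomial.C r * Polynomial.X, Polynomial.X])
    ?_ (by simp [MvPolynomial.algHom_C]) (by simp) ?_ four_pos (X_sub_C_coords_mem_span_line r) ?_
  · intro i
    fin_cases i <;> simp [coords]
  · rw [aeval_line_chart, hr, map_zero, zero_mul, zero_add]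
    exact dvd_mul_left _ _
  · have hr1 : r ^ 2 - 1 ≠ 0 := fun h => had (by linear_combination hr + d * h)
    have hu : IsUnit (germ a d .Omega1 (MvPolynomial.C (r ^ 2 - 1))) :=
      isUnit_germ (by simpa using hr1)
    refine hu.dvd_mul_left.mp ?_
    rw [← map_pow, ← map_mul]
    refine germ_dvd_germ_of_sub_eq ((MvPolynomial.C d - MvPolynomial.X 1 ^ 2) *
      (MvPolynomial.X 0 + MvPolynomial.C r * MvPolynomial.X 1)) 1 ?_
    have hC := congrArg (MvPolynomial.C (σ := Fin 2)) hr
    simp only [map_sub, map_mul, map_pow, map_zero] at hC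
    simp only [chart_Omega1_curveForm, map_sub, map_pow, map_one]
    linear_combination -MvPolynomial.X 1 ^ 2 * hC

instance (p : PlanePt k) : Algebra k (Germ a d p) := ((germ a d p).comp MvPolynomial.C).toAlgebra

/-- `germ` as a homomorphism of algebras. -/
def germₐ (a d : k) (p : PlanePt k) : MvPolynomial (Fin 2) k →ₐ[k] Germ a d p :=
  { germ a d p with commutes' := fun _ => rfl }

theorem neg_one_mul_self (i : Fin 2) :
    (fun _ => -1 : Fin 2 → k) i * (fun _ => -1 : Fin 2 → k) i = 1 := by
  norm_num

/-- The norm of `q_P` near `Ω₁`, with denominators cleared. -/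
theorem germ_Omega1_norm [IsAlgClosed k] (hd : d ≠ 0) (q₁ q₂ : Polynomial k) :
    germ a d .Omega1 (MvPolynomial.X 1) ^ 2 * (lineGerm a d 1 * lineGerm a d (-1)) *
        (germ a d .Omega1 (chart .Omega1 (homogenization (qPoly q₁ q₂))) *
          germ a d .Omega1 (signAut (fun _ => -1) neg_one_mul_self
            (chart .Omega1 (homogenization (qPoly q₁ q₂))))) *
        germ a d .Omega1 (MvPolynomial.X 1) ^ ((QPoly a d q₁ q₂).roots.card + 1) =
      germ a d .Omega1 (MvPolynomial.C
        (-(-1) ^ (qPoly q₁ q₂).totalDegree * (QPoly a d q₁ q₂).leadingCoeff)) *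
        (germ a d .Omega1 (MvPolynomial.X 1) ^ (2 * (qPoly q₁ q₂).totalDegree + 2) *
          (lineGerm a d (-1) * ((QPoly a d q₁ q₂).roots.map (lineGerm a d)).prod)) := by
  have hz := germ_Omega1_z_mem_nonZeroDivisors (a := a) hd
  -- In the total ring of fractions `z` has an inverse `w`. There `w` and `η = y w` are the affine
  -- coordinates `x` and `y`, so the norm relation can be used in its affine form.
  let K := FractionRing (Germ a d .Omega1)
  let ψ : MvPolynomial (Fin 2) k →ₐ[k] K :=
    (IsScalarTower.toAlgHom k (Germ a d .Omega1) K).comp (germₐ a d .Omega1)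
  have hψ : ∀ f, algebraMap (Germ a d .Omega1) K (germ a d .Omega1 f) = ψ f := fun _ => rfl
  refine IsFractionRing.injective (Germ a d .Omega1) K ?_
  obtain ⟨y, hy⟩ : ∃ y, y = ψ (MvPolynomial.X 0) := ⟨_, rfl⟩
  obtain ⟨z, hz'⟩ : ∃ z, z = ψ (MvPolynomial.X 1) := ⟨_, rfl⟩
  have hzu : IsUnit z := by
    rw [hz']
    exact IsLocalization.map_units K (⟨_, hz⟩ : nonZeroDivisors (Germ a d .Omega1))
  obtain ⟨w, hw⟩ := hzu.exists_right_inv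
  have hcurve : algebraMap k K a * z ^ 2 + y ^ 2 * z ^ 2 - z ^ 4 -
      algebraMap k K d * y ^ 2 = 0 := by
    have h : ψ (chart .Omega1 (curveForm a d)) = 0 := by
      rw [← hψ, germ_curve, map_zero]
    rw [chart_Omega1_curveForm] at h
    simpa [MvPolynomial.algHom_C, ← hy, ← hz'] using h
  have hline : ∀ r, algebraMap (Germ a d .Omega1) K (lineGerm a d r) =
      y - algebraMap k K r * z := by
    intro r
    rw [lineGerm, hψ]
    simp [MvPolynomial.algHom_C, ← hy, ← hz']
  have hH : ∀ h : MvPolynomial (Fin 2) k, ψ (chart .Omega1 (homogenization h)) =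
      z ^ h.totalDegree * MvPolynomial.aeval ![w, y * w] h := by
    intro h
    have := aeval_homogenization h 1 y z w hw
    rw [one_mul] at this
    rw [← this]
    have hcomp : ψ.comp (chart .Omega1) = MvPolynomial.aeval ![1, y, z] :=
      MvPolynomial.algHom_ext fun i => by
        fin_cases i <;> simp [chart, hy, hz']
    exact DFunLike.congr_fun hcomp _
  -- Since `[1, -y, -z] = [-1, y, z]`, changing both signs in the chart is the reflection `x ↦ -x`.
  have hH' : ∀ h : MvPolynomial (Fin 2) k,
      ψ (signAut (fun _ => -1) neg_one_mul_self (chart .Omega1 (homogenization h))) =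
      (-z) ^ h.totalDegree * MvPolynomial.aeval ![-w, y * w] h := by
    intro h
    have := aeval_homogenization h 1 (-y) (-z) (-w) (by rw [neg_mul_neg, hw])
    rw [one_mul, neg_mul_neg] at this
    rw [← this]
    have hcomp : (ψ.comp (signAut (fun _ => -1) neg_one_mul_self).toAlgHom).comp (chart .Omega1) =
        MvPolynomial.aeval ![1, -y, -z] :=
      MvPolynomial.algHom_ext fun i => by
        fin_cases i <;> simp [chart, signAut_apply, hy, hz']
    exact DFunLike.congr_fun hcomp _
  have hQ : z ^ (QPoly a d q₁ q₂).roots.card * Polynomial.aeval (y * w) (QPoly a d q₁ q₂) =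
      algebraMap k K (QPoly a d q₁ q₂).leadingCoeff *
        ((QPoly a d q₁ q₂).roots.map fun r => y - algebraMap k K r * z).prod := by
    conv_lhs =>
      enter [2]
      rw [(IsAlgClosed.splits (QPoly a d q₁ q₂)).eq_prod_roots]
    rw [map_mul, Polynomial.aeval_C, map_multiset_prod, Multiset.map_map, mul_left_comm]
    congr 1
    induction (QPoly a d q₁ q₂).roots using Multiset.induction with
    | empty => simp
    | cons r s ih =>
      rw [Multiset.card_cons, Multiset.map_cons, Multiset.map_cons, Multiset.prod_cons,
        Multiset.prod_cons, ← ih, pow_succ]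
      simp only [Function.comp_apply, map_sub, Polynomial.aeval_X, Polynomial.aeval_C]
      linear_combination (z ^ s.card * y *
        (s.map fun r => y * w - algebraMap k K r).prod) * hw
  obtain ⟨η, hη⟩ : ∃ η, η = y * w := ⟨_, rfl⟩
  have hyη : y = η * z := by rw [hη, mul_assoc, mul_comm w, hw, mul_one]
  have hw2 : z ^ 2 * w ^ 2 = 1 := by rw [← mul_pow, hw, one_pow]
  -- With `a - d η² = z² (1 - η²)`, this factor of the norm becomes the product of the lines `Y =
  -- ±Z` up to sign; the factor `1 + η` of the other side supplies one more line `Y = -Z`.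
  have hcurve' : algebraMap k K a - algebraMap k K d * η ^ 2 = z ^ 2 * (1 - η ^ 2) := by
    rw [hyη] at hcurve
    linear_combination w ^ 2 * hcurve -
      (algebraMap k K a + η ^ 2 * z ^ 2 - z ^ 2 - algebraMap k K d * η ^ 2) * hw2
  rw [aeval_QPoly] at hQ
  simp only [map_mul, map_pow, hline, map_multiset_prod, Multiset.map_map, Function.comp_def]
  rw [hψ, hψ, hψ, hψ, hH, hH', aeval_qPoly, aeval_qPoly, MvPolynomial.algHom_C, ← hz', ← hη,
    neg_pow z]
  rw [← hη] at hQ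
  simp only [map_neg, map_pow, map_one]
  generalize ((QPoly a d q₁ q₂).roots.map fun r => y - algebraMap k K r * z).prod = R at hQ ⊢
  generalize (QPoly a d q₁ q₂).roots.card = D at hQ ⊢
  generalize (qPoly q₁ q₂).totalDegree = m
  generalize Polynomial.aeval η q₁ = A at hQ ⊢
  generalize Polynomial.aeval η q₂ = B at hQ ⊢
  rw [hyη]
  have hpow : z ^ (2 * m + 2) = z ^ m * z ^ m * z ^ 2 := by ring
  rw [hpow, pow_succ z D]
  linear_combination (-(-1) ^ m * z ^ m * z ^ m * z ^ 3 * (1 + η)) * hQ +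
    ((-1) ^ m * z ^ m * z ^ m * z ^ D * z ^ 3 * (1 + η) ^ 2 * A ^ 2) * hcurve' -
    ((-1) ^ m * z ^ m * z ^ m * z ^ D * z ^ 3 * (1 + η) * (η - 1) * B ^ 2) * hw2

theorem mult_Omega1_z (hd : d ≠ 0) : mult a d (MvPolynomial.X 2) .Omega1 = 2 := by
  rw [mult_eq_ord_germ, ← ord_germ_Omega1_z (a := a) hd]
  simp [chart]

/-- Orders of both sides of `germ_Omega1_norm`. The two conjugate factors contribute equally, as the
reflection fixes `Ω₁`. -/
theorem two_mul_mult_Omega1 [IsAlgClosed k] (hd : d ≠ 0) (had : a ≠ d) {q₁ q₂ : Polynomial k}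
    (hQ : QPoly a d q₁ q₂ ≠ 0) :
    2 * mult a d (homogenization (qPoly q₁ q₂)) .Omega1 + 2 * (QPoly a d q₁ q₂).roots.card + 4 =
      4 * (qPoly q₁ q₂).totalDegree +
        ((QPoly a d q₁ q₂).roots.map fun r => Ring.ord _ (lineGerm a d r)).sum := by
  have hinv := ord_germ_ringEquiv (a := a) (d := d) (p := .Omega1) (p' := .Omega1)
    (signAut (fun _ => -1) neg_one_mul_self).toRingEquiv
    (by
      simp [chart_Omega1_curveForm, signAut_apply, MvPolynomial.algHom_C]
      ring)
    (fun g => by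
      refine (eval_signAut _ neg_one_mul_self g _).trans ?_
      congr 2
      ext i
      simp [coords_Omega1]) (chart .Omega1 (homogenization (qPoly q₁ q₂)))
  change Ring.ord _ (germ a d .Omega1 (signAut (fun _ => -1) neg_one_mul_self _)) = _ at hinv
  have hnorm := germ_Omega1_norm (a := a) hd q₁ q₂
  have hz := germ_Omega1_z_mem_nonZeroDivisors (a := a) hd
  have hline := lineGerm_mem_nonZeroDivisors (a := a) had
  obtain ⟨h₁, h₂⟩ := ord_multiset_prod (lineGerm a d) (QPoly a d q₁ q₂).roots fun r _ => hline r
  have hu : IsUnit (germ a d .Omega1 (MvPolynomial.C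
      (-(-1) ^ (qPoly q₁ q₂).totalDegree * (QPoly a d q₁ q₂).leadingCoeff))) :=
    isUnit_germ (by simpa using hQ)
  have hR := mul_mem (mul_mem (pow_mem hz (2 * (qPoly q₁ q₂).totalDegree + 2)) (hline (-1))) h₁
  have hnzd := mul_mem hu.mem_nonZeroDivisors hR
  rw [mul_assoc (_ ^ _), ← hnorm] at hnzd
  have hH := mul_mem_nonZeroDivisors.mp (mul_mem_nonZeroDivisors.mp
    (mul_mem_nonZeroDivisors.mp hnzd).1).2
  have hord := congrArg (Ring.ord _) hnorm
  have hl1 : Ring.ord _ (lineGerm a d 1) = 2 := ord_lineGerm 1 (by simpa [sub_eq_zero] using had)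
  have hl2 : Ring.ord _ (lineGerm a d (-1)) = 2 :=
    ord_lineGerm (-1) (by simpa [sub_eq_zero] using had)
  rw [ord_mul_of_isUnit hu, Ring.ord_mul _ (mul_mem (hline _) h₁), Ring.ord_mul _ h₁, h₂,
    Ring.ord_mul _ (pow_mem hz _), Ring.ord_mul _ (mul_mem hH.1 hH.2), Ring.ord_mul _ hH.2, hinv,
    Ring.ord_mul _ (mul_mem (hline _) (hline _)), Ring.ord_mul _ (hline _), Ring.ord_pow hz,
    Ring.ord_pow hz, Ring.ord_pow hz, ord_germ_Omega1_z hd, hl1, hl2] at hord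
  rw [mult_eq_ord_germ]
  generalize Ring.ord _ (germ a d .Omega1 (chart .Omega1 (homogenization (qPoly q₁ q₂)))) = M
    at hord ⊢
  generalize ((QPoly a d q₁ q₂).roots.map fun r => Ring.ord _ (lineGerm a d r)).sum = S
    at hord ⊢
  -- The orders of `z` and of the lines `Y = ±Z` leave constants 10 and 6 on the two sides; the
  -- common 6 is finite and may be cancelled in `ℕ∞`.
  refine ENat.add_right_injective_of_ne_top (n := 6) (ENat.natCast_ne_top 6) ?_
  dsimp only
  convert hord using 1
  · simp only [nsmul_eq_mul]
    push_cast
    ring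
  · simp only [nsmul_eq_mul]
    push_cast
    ring

/-- A polynomial with the prescribed order at `Ω₁` has a norm that does not vanish on the lines
tangent to the curve there. -/
theorem a_sub_ne_zero_of_mem_roots [IsAlgClosed k] (hd : d ≠ 0) (had : a ≠ d)
    {q₁ q₂ : Polynomial k} (hQ : QPoly a d q₁ q₂ ≠ 0)
    (hdiv : divisor a d (qPoly q₁ q₂) .Omega1 = -2) {r : k} (hr : r ∈ (QPoly a d q₁ q₂).roots) :
    a - d * r ^ 2 ≠ 0 := by
  intro h
  have hmul := two_mul_mult_Omega1 hd had hQ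
  rw [divisor, mult_Omega1_z hd] at hdiv
  obtain ⟨s, hs⟩ := Multiset.exists_cons_of_mem hr
  have hval : ∀ r, Ring.ord _ (lineGerm a d r) = ((if a - d * r ^ 2 = 0 then 4 else 2 : ℕ) : ℕ∞) :=
    fun r => by
      split_ifs with h
      · exact ord_lineGerm_of_tangent had r h
      · exact ord_lineGerm r h
  have hcast : ∀ s : Multiset k, (s.map fun r => Ring.ord _ (lineGerm a d r)).sum =
      ((s.map fun r => if a - d * r ^ 2 = 0 then 4 else 2).sum : ℕ) := fun s => by
    simp only [hval, Nat.cast_multiset_sum, Multiset.map_map, Function.comp_def]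
  have hsum : s.card * 2 ≤ (s.map fun r => if a - d * r ^ 2 = 0 then 4 else 2).sum := by
    have := Multiset.card_nsmul_le_sum (s := s.map fun r => if a - d * r ^ 2 = 0 then 4 else 2)
      (a := 2) (by
        intro x hx
        obtain ⟨r, -, rfl⟩ := Multiset.mem_map.mp hx
        split_ifs <;> norm_num)
    simpa using this
  rw [hcast, hs, Multiset.map_cons, Multiset.sum_cons, Multiset.card_cons, if_pos h] at hmul
  -- `toNat` sends `⊤` to `0`, so the divisor alone does not exclude infinite multiplicity; the
  -- finite right side of `hmul` does.
  have hfin : mult a d (homogenization (qPoly q₁ q₂)) .Omega1 ≠ ⊤ := by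
    intro htop
    rw [htop, ENat.mul_top two_ne_zero, top_add, top_add] at hmul
    exact ENat.natCast_ne_top _ hmul.symm
  obtain ⟨M, hM⟩ := ENat.ne_top_iff_exists.mp hfin
  rw [← hM] at hdiv hmul
  norm_cast at hmul
  simp only [ENat.toNat_natCast, ENat.toNat_ofNat] at hdiv
  push_cast at hdiv
  -- With `m` the total degree, the multiplicity is `2 m - 2`, so the orders of the lines sum to
  -- twice the number of roots. All are at least 2 and the one for `r` is 4, a contradiction.
  omega

end Omega

/-! ### The roots of `Q_P` -/

section Roots

variable {k : Type*} [Field k] {a d : k}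

theorem mult_affine_X_two (x y : k) : mult a d (MvPolynomial.X 2) (.affine x y) = 0 := by
  rw [mult_eq_ord_germ]
  refine ord_of_isUnit (isUnit_germ ?_)
  simp [chart]

theorem divisor_affine (h : MvPolynomial (Fin 2) k) (x y : k) :
    divisor a d h (.affine x y) = ((mult a d (homogenization h) (.affine x y)).toNat : ℤ) := by
  simp [divisor, mult_affine_X_two]

theorem conjDivisor_affine (q n : ℕ) (u v x y : k) :
    conjDivisor q n u v (.affine x y) =
      (((Multiset.range n).countP fun i => u ^ q ^ i = x ∧ v ^ q ^ i = y : ℕ) : ℤ) +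
        if x = 0 ∧ y = -1 then 1 else 0 := by
  simp only [conjDivisor, Finsupp.coe_sub, Finsupp.coe_add, Pi.sub_apply, Pi.add_apply,
    Finsupp.finsetSum_apply, Finsupp.single_apply, PlanePt.affine.injEq, reduceCtorEq, if_false,
    sub_zero]
  congr 1
  · rw [Finset.sum_boole, Multiset.countP_eq_card_filter]
    rfl
  · simp only [eq_comm]

theorem conjDivisor_Omega1 (q n : ℕ) (u v : k) : conjDivisor q n u v .Omega1 = -2 := by
  simp [conjDivisor]

/-- The zero polynomial has total degree 0, so the subtracted term of its divisor disappears. -/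
theorem qPoly_ne_zero_of_divisor_neg {q₁ q₂ : Polynomial k} {p : PlanePt k}
    (h : divisor a d (qPoly q₁ q₂) p < 0) : q₁ ≠ 0 ∨ q₂ ≠ 0 := by
  by_contra! h0
  rw [h0.1, h0.2] at h
  simp [divisor, qPoly] at h
  omega

theorem roots_QPoly [IsAlgClosed k] (h2 : (2 : k) ≠ 0) (hd : d ≠ 0) (had : a ≠ d)
    {q₁ q₂ : Polynomial k} {q n : ℕ} {u v : k}
    (hP : ∀ i, a * (u ^ q ^ i) ^ 2 + (v ^ q ^ i) ^ 2 =
      1 + d * (u ^ q ^ i) ^ 2 * (v ^ q ^ i) ^ 2)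
    (hdiv : divisor a d (qPoly q₁ q₂) = conjDivisor q n u v) :
    QPoly a d q₁ q₂ ≠ 0 ∧
      (QPoly a d q₁ q₂).roots = (Multiset.range n).map fun i => v ^ q ^ i := by
  have hΩ : divisor a d (qPoly q₁ q₂) .Omega1 = -2 := by rw [hdiv, conjDivisor_Omega1]
  have hQ : QPoly a d q₁ q₂ ≠ 0 :=
    QPoly_ne_zero h2 had (qPoly_ne_zero_of_divisor_neg (hΩ.trans_lt (by norm_num)))
  refine ⟨hQ, Multiset.ext.mpr fun y => ?_⟩
  rw [Multiset.count_map, ← Multiset.countP_eq_card_filter]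
  -- No affine point has such a `y`, so the count of conjugates is zero, and that of roots is zero
  -- by the order at `Ω₁`. For every other `y` there is an affine point of the curve above it.
  by_cases hy : a - d * y ^ 2 = 0
  · rw [Multiset.count_eq_zero_of_notMem
      fun h => a_sub_ne_zero_of_mem_roots hd had hQ hΩ h hy, eq_comm, Multiset.countP_eq_zero]
    rintro i - rfl
    exact a_sub_ne_zero had (hP i) hy
  obtain ⟨x, hx⟩ := IsAlgClosed.exists_pow_nat_eq ((1 - y ^ 2) / (a - d * y ^ 2)) two_pos
  have hp : a * x ^ 2 + y ^ 2 = 1 + d * x ^ 2 * y ^ 2 := by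
    rw [eq_div_iff hy] at hx
    linear_combination hx
  have hcount : ((1 + Polynomial.X) * QPoly a d q₁ q₂).roots.count y =
      (if y = -1 then 1 else 0) + (QPoly a d q₁ q₂).roots.count y := by
    have hX : (1 + Polynomial.X : Polynomial k) = Polynomial.X - Polynomial.C (-1) := by
      rw [map_neg, map_one]
      ring
    rw [hX, Polynomial.roots_mul (mul_ne_zero (Polynomial.X_sub_C_ne_zero _) hQ),
      Polynomial.roots_X_sub_C, Multiset.count_add, Multiset.count_singleton]
  have hsum := mult_affine_add_mult_neg h2 had hp hQ
  have hcoe : (((1 + Polynomial.X) * QPoly a d q₁ q₂).roots.count y : ℕ∞) *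
      (if x = 0 then 2 else 1) = ((((1 + Polynomial.X) * QPoly a d q₁ q₂).roots.count y *
        if x = 0 then 2 else 1 : ℕ) : ℕ∞) := by
    split_ifs <;> simp
  rw [hcoe] at hsum
  have hfin := hsum.trans_ne (ENat.natCast_ne_top _)
  have hsum' := congrArg ENat.toNat hsum
  rw [ENat.toNat_add (fun h => hfin (by rw [h, top_add])) (fun h => hfin (by rw [h, add_top])),
    ENat.toNat_natCast, hcount] at hsum'
  have h₁ := congrFun hdiv (.affine x y)
  have h₂ := congrFun hdiv (.affine (-x) y)
  rw [divisor_affine, conjDivisor_affine] at h₁ h₂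
  have hux : ∀ i, v ^ q ^ i = y → (u ^ q ^ i) ^ 2 = x ^ 2 := by
    rintro i rfl
    refine mul_right_cancel₀ hy ?_
    linear_combination hP i - hp
  -- For `x = 0` the two opposite points coincide and both sides of `hsum'` are doubled. Otherwise
  -- the conjugates with second coordinate `y` are split between `(x, y)` and `(-x, y)`, and `𝒪'` is
  -- neither of them.
  by_cases hx0 : x = 0
  · subst hx0
    have hcongr : ((Multiset.range n).countP fun i => u ^ q ^ i = 0 ∧ v ^ q ^ i = y) =
        (Multiset.range n).countP fun i => y = v ^ q ^ i := by
      refine Multiset.countP_congr rfl fun i _ => ?_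
      refine propext ⟨fun h => h.2.symm, fun h => ⟨?_, h.symm⟩⟩
      simpa using hux i h.symm
    rw [neg_zero] at h₂ hsum'
    rw [hcongr] at h₁
    simp only [true_and, if_true] at h₁ hsum'
    split_ifs at h₁ hsum' <;> omega
  · have hneg : x ≠ -x := fun h => hx0 (by
      have : 2 * x = 0 := by linear_combination h
      exact (mul_eq_zero.mp this).resolve_left h2)
    have hy1 : y ≠ -1 := by
      rintro rfl
      have : (a - d) * x ^ 2 = 0 := by linear_combination hp
      exact (mul_ne_zero (sub_ne_zero.mpr had) (pow_ne_zero 2 hx0)) this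
    have hcongr : ((Multiset.range n).countP fun i => y = v ^ q ^ i) =
        ((Multiset.range n).countP fun i => u ^ q ^ i = x ∧ v ^ q ^ i = y) +
          (Multiset.range n).countP fun i => u ^ q ^ i = -x ∧ v ^ q ^ i = y := by
      simp only [Multiset.countP_eq_card_filter]
      rw [← Multiset.card_add, Multiset.filter_add_filter,
        (Multiset.filter_eq_nil (p := fun i => (u ^ q ^ i = x ∧ v ^ q ^ i = y) ∧
          u ^ q ^ i = -x ∧ v ^ q ^ i = y)).mpr fun i _ h => hneg (h.1.1.symm.trans h.2.1), add_zero]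
      congr 1
      refine Multiset.filter_congr fun i _ => ?_
      constructor
      · intro h
        rcases sq_eq_sq_iff_eq_or_eq_neg.mp (hux i h.symm) with h' | h'
        · exact Or.inl ⟨h', h.symm⟩
        · exact Or.inr ⟨h', h.symm⟩
      · rintro (h | h) <;> exact h.2.symm
    simp only [hy1, and_false, if_false, hx0] at h₁ h₂ hsum'
    omega

end Roots

end

end TwistedEdwards

/-! ### Descent to the field of definition -/

theorem mainTheorem2 {F L : Type*} [Field F] [Fintype F] [Field L] [Algebra F L]
    (n : ℕ) (hn : n.Prime) (hn2 : n ≠ 2) (hL : Module.finrank F L = n) (hF : ringChar F ≠ 2)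
    (a d : F) (ha : a ≠ 0) (hd : d ≠ 0) (had : a ≠ d)
    (u v : L)
    (hP : TwistedEdwards.affinePt u v ∈ TwistedEdwards.traceZero
      (algebraMap F L a) (algebraMap F L d) (Fintype.card F) n)
    (qhat₁ q₂ : Polynomial F)
    (hq : TwistedEdwards.divisor
        (algebraMap F (AlgebraicClosure L) a) (algebraMap F (AlgebraicClosure L) d)
        (MvPolynomial.map (algebraMap F (AlgebraicClosure L)) (TwistedEdwards.qPoly qhat₁ q₂)) =
      TwistedEdwards.conjDivisor (Fintype.card F) n
        (algebraMap L (AlgebraicClosure L) u) (algebraMap L (AlgebraicClosure L) v)) :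
    (TwistedEdwards.QPoly a d qhat₁ q₂).degree = n ∧
    (TwistedEdwards.QPoly a d qhat₁ q₂).aroots (AlgebraicClosure L) =
      (Multiset.range n).map
        (fun i => algebraMap L (AlgebraicClosure L) (v ^ Fintype.card F ^ i)) := by
  have hcurve : algebraMap F L a * u ^ 2 + v ^ 2 = 1 + algebraMap F L d * u ^ 2 * v ^ 2 := by
    have h := hP.1
    simpa [TwistedEdwards.points, TwistedEdwards.hom, TwistedEdwards.affinePt] using h
  have hinj : Function.Injective (algebraMap F (AlgebraicClosure L)) :=
    (algebraMap F (AlgebraicClosure L)).injective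
  have hconj : ∀ i : ℕ, algebraMap F L a * (u ^ Fintype.card F ^ i) ^ 2 +
      (v ^ Fintype.card F ^ i) ^ 2 =
      1 + algebraMap F L d * (u ^ Fintype.card F ^ i) ^ 2 * (v ^ Fintype.card F ^ i) ^ 2 := by
    intro i
    induction i with
    | zero => simpa using hcurve
    | succ i ih =>
      -- Frobenius fixes `a` and `d`, so the conjugates of `P` stay on the curve.
      have h := congrArg (FiniteField.frobeniusAlgHom F L) ih
      simp only [map_add, map_mul, map_pow, map_one, AlgHom.commutes] at h
      simpa only [FiniteField.coe_frobeniusAlgHom, pow_succ' (Fintype.card F), pow_mul] using h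
  rw [TwistedEdwards.map_qPoly] at hq
  obtain ⟨hQ, hroots⟩ := TwistedEdwards.roots_QPoly
    (by
      rw [← map_ofNat (algebraMap F (AlgebraicClosure L)) 2]
      exact (map_ne_zero _).mpr (Ring.two_ne_zero hF))
    ((map_ne_zero _).mpr hd) (hinj.ne had)
    (fun i => by
      have h := congrArg (algebraMap L (AlgebraicClosure L)) (hconj i)
      simpa [← IsScalarTower.algebraMap_apply] using h) hq
  rw [← TwistedEdwards.map_QPoly] at hQ hroots
  have haroots : (TwistedEdwards.QPoly a d qhat₁ q₂).aroots (AlgebraicClosure L) =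
      (Multiset.range n).map
        (fun i => algebraMap L (AlgebraicClosure L) (v ^ Fintype.card F ^ i)) := by
    rw [Polynomial.aroots_def, hroots]
    simp
  refine ⟨?_, haroots⟩
  -- Over the algebraic closure the degree is the number of roots with multiplicity, and base change
  -- preserves it.
  have hcard := (IsAlgClosed.splits ((TwistedEdwards.QPoly a d qhat₁ q₂).map
    (algebraMap F (AlgebraicClosure L)))).natDegree_eq_card_roots
  rw [hroots, Multiset.card_map, Multiset.card_range, Polynomial.natDegree_map] at hcard
  rw [Polynomial.degree_eq_natDegree (by rintro h; simp [h] at hQ), hcard]
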